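/- Let $X$ be a compact metric space with Borel $\sigma$-algebra $\mathcal B_X$, let $(T^{(m,n)})_{(m,n)\in\mathbb Z^2}$ be an action of the group $\mathbb Z^2$ on $X$ by homeomorphisms, and let $\mu$ be a Borel probability measure on $X$ with $\mu(T^{-(m,n)}A)=\mu(A)$ for all $(m,n)\in\mathbb Z^2$ and $A\in\mathcal B_X$. Let $\beta\in\mathbb R$, $\vec v=(1,\beta)$, and for $b\in(0,\infty)$ and $k\in\mathbb N$ put $$\Lambda^{\vec v}(b)=\{(m,n)\in\mathbb Z^2:\ \beta m-b/2\le n\le \beta m+b/2\},\qquad \Lambda^{\vec v}_k(b)=\Lambda^{\vec v}(b)\cap([0,k-1]\times\mathbb Z).$$ The $\vec v$-directional Kronecker algebra is $$\mathcal K_\mu^{\vec v}=\Bigl\{B\in\mathcal B_X:\ \overline{\{1_B\circ T^{(m,n)}:(m,n)\in\Lambda^{\vec v}(a)\}}\ \text{is compact in } L^2(X,\mathcal B_X,\mu)\Bigr\},$$ where $a\in(0,\infty)$ is arbitrary (the choice of $a$ does not matter). The system $(X,\mathcal B_X,\mu,T)$ is called $\vec v$-weak mixing if $\mathcal K_\mu^{\vec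 v}=\{\emptyset,X\}$ modulo $\mu$-null sets. Then for every $b\in(0,\infty)$ the following statements are equivalent. (a) $(X,\mathcal B_X,\mu,T)$ is $\vec v$-weak mixing. (b) For all $B,C\in\mathcal B_X$ there is a subset $\mathcal Q_{B,C}\subset\Lambda^{\vec v}(b)$ with $$\lim_{k\to\infty}\frac{\#\bigl(\mathcal Q_{B,C}\cap([0,k-1]\times\mathbb Z)\bigr)}{\#\Lambda^{\vec v}_k(b)}=1$$ such that $\lim_{i\to\infty}\mu(T^{-(m_i,n_i)}B\cap C)=\mu(B)\mu(C)$ for every sequence $\{(m_i,n_i)\}_{i=1}^\infty$ in $\mathcal Q_{B,C}$ whose first coordinates are strictly increasing, $m_1<m_2<\cdots$. (c) For all $B,C\in\mathcal B_X$ there is a subset $\mathcal Q_{B,C}\subset\Lambda^{\vec v}(b)$ with $$\lim_{k\to\infty}\frac{\#\bigl(\mathcal Q_{B,C}\cap([0,k-1]\times\mathbb Z)\bigr)}{\#\Lambda^{\vec v}_k(b)}=1$$ such that $\lim_{i\to\infty}\mu(T^{-(m_i,n_i)}B\cap C)=\mu(B)\mu(C)$ for every sequence $\{(m_i,n_i)\}_{i=1}^\infty$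 of pairwise distinct elements of $\mathcal Q_{B,C}$. -/

import Mathlib

open MeasureTheory Filter Topology

/-- The strip `Λ^v(b) = {(m, n) ∈ ℤ² : β m - b/2 ≤ n ≤ β m + b/2}` around the line through the
origin with direction `v = (1, β)`. -/
def directionStrip (β b : ℝ) : Set (ℤ × ℤ) :=
  {p | β * (p.1 : ℝ) - b / 2 ≤ (p.2 : ℝ) ∧ (p.2 : ℝ) ≤ β * (p.1 : ℝ) + b / 2}

/-- The vertical band `[0, k - 1] × ℤ`. -/
def verticalBand (k : ℕ) : Set (ℤ × ℤ) :=
  {p | 0 ≤ p.1 ∧ p.1 ≤ (k : ℤ) - 1}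

/-- `Λ_k^v(b) = Λ^v(b) ∩ ([0, k - 1] × ℤ)`. -/
def directionStripTrunc (β b : ℝ) (k : ℕ) : Set (ℤ × ℤ) :=
  directionStrip β b ∩ verticalBand k

/-- `Λ_k^v(b)` is a finite set, so that its `ncard` is its number of elements. -/
theorem directionStripTrunc_finite (β b : ℝ) (k : ℕ) : (directionStripTrunc β b k).Finite := by
  have h : directionStripTrunc β b k ⊆
      ⋃ m ∈ Set.Icc (0 : ℤ) ((k : ℤ) - 1),
        (fun n : ℤ => (m, n)) '' Set.Icc ⌈β * (m : ℝ) - b / 2⌉ ⌊β * (m : ℝ) + b / 2⌋ := by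
    rintro ⟨m, n⟩ ⟨⟨h1, h2⟩, h3, h4⟩
    simp only [Set.mem_iUnion]
    exact ⟨m, ⟨h3, h4⟩, n, ⟨Int.ceil_le.mpr h1, Int.le_floor.mpr h2⟩, rfl⟩
  exact ((Set.finite_Icc _ _).biUnion fun _ _ => (Set.finite_Icc _ _).image _).subset h

/-- The set `Q` has relative density one in the strip `Λ^v(b)`:
`#(Q ∩ ([0, k - 1] × ℤ)) / #(Λ_k^v(b)) → 1` as `k → ∞`. It is used for `Q ⊆ Λ^v(b)`. -/
def HasStripDensityOne (β b : ℝ) (Q : Set (ℤ × ℤ)) : Prop :=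
  Tendsto (fun k : ℕ =>
      ((Q ∩ verticalBand k).ncard : ℝ) / ((directionStripTrunc β b k).ncard : ℝ))
    atTop (𝓝 1)

section MeasurePreserving

variable {X : Type*} [MeasurableSpace X] [AddAction (ℤ × ℤ) X] [MeasurableConstVAdd (ℤ × ℤ) X]

/-- The Koopman operator `U_T^g f = f ∘ T^g` on the complex Hilbert space `L²(X, μ)`, where
`T^g x = g +ᵥ x` is the given `ℤ²`-action. -/
noncomputable def koopman (μ : Measure X) [VAddInvariantMeasure (ℤ × ℤ) X μ] (g : ℤ × ℤ) :
    Lp ℂ 2 μ →ₗᵢ[ℂ] Lp ℂ 2 μ :=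
  Lp.compMeasurePreservingₗᵢ ℂ (fun x : X => g +ᵥ x) (measurePreserving_vadd g μ)

/-- The directional Kronecker algebra of the direction `v = (1, β)`, computed with the strip of
width `b`: all measurable sets `B` such that the closure of `{U_T^g 1_B : g ∈ Λ^v(b)}` is compact
in `L²(X, μ)`. -/
def directionalKronecker (μ : Measure X) [IsFiniteMeasure μ] [VAddInvariantMeasure (ℤ × ℤ) X μ]
    (β b : ℝ) : Set (Set X) :=
  {B | ∃ hB : MeasurableSet B,
    IsCompact (closure ((fun g : ℤ × ℤ =>
      koopman μ g (indicatorConstLp 2 hB (measure_ne_top μ B) (1 : ℂ))) '' directionStrip β b))}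

/-- Weak mixing in the direction `v = (1, β)`: the directional Kronecker algebra is the trivial
algebra `{∅, X}`, where measurable sets are identified if they differ by a null set. -/
def IsDirectionalWeakMixing (μ : Measure X) [IsFiniteMeasure μ]
    [VAddInvariantMeasure (ℤ × ℤ) X μ] (β b : ℝ) : Prop :=
  ∀ B ∈ directionalKronecker μ β b, B =ᵐ[μ] (∅ : Set X) ∨ B =ᵐ[μ] (Set.univ : Set X)

/-- Convergence along the sequence `s i = (m_i, n_i)` of
`μ(T^{-(m_i, n_i)} B ∩ C)` to `μ(B) μ(C)`. -/
def MixesAlong (μ : Measure X) (B C : Set X) (s : ℕ → ℤ × ℤ) : Prop :=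
  Tendsto (fun i : ℕ => μ.real (((fun x : X => s i +ᵥ x) ⁻¹' B) ∩ C)) atTop
    (𝓝 (μ.real B * μ.real C))

end MeasurePreserving

open scoped Finset BigOperators InnerProductSpace

/-!
The sets of relative density one in the truncated strips `Λ_k^v(b)` form a filter.

*Weak mixing implies mixing along a set of density one.* For a fixed `ψ`, the empirical covariance
operators `𝔼 ⟪U^g f, ·⟫ U^g f` over `g ∈ Λ_k^v(b)`, applied to `ψ`, have a weak limit point `w`.
Since translates of `Λ_k^v(b)` by elements of a strip of bounded width stay, up to a negligible
part, in a comparable strip, the orbit of `w` along the strip is dominated by a quadratic form whose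
sum over orthonormal families is bounded, and is therefore totally bounded. The level sets of an
almost periodic vector lie in the Kronecker algebra, so under weak mixing `w` is constant, and `w`
vanishes when `f = 1_B - μ(B)`. Hence the squared correlations of `f` tend to zero in average, and
the Koopman–von Neumann argument upgrades this to convergence along a set of density one.

*Mixing along density-one sets implies weak mixing.* If `B` is in the Kronecker algebra, the vectors
`U^g 1_B` have a strong limit point `u` along the density-one filter. Mixing gives
`⟪u, U^h 1_B⟫ = μ(B)²` for every `h`, so `μ(B) = ‖u‖² = μ(B)²` and `B` is trivial.
-/

section DensityOne

variable {ι α : Type*} {E : ι → Finset α} {l : Filter ι}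

open Classical in
/-- The filter of all sets of relative density one in the finite sets `E k` along `l`. Density one
is expressed as density zero of the complement, so that empty sets `E k` do no harm. -/
noncomputable def densityOneFilter (E : ι → Finset α) (l : Filter ι) : Filter α where
  sets := {Q | Tendsto (fun k => (#{g ∈ E k | g ∉ Q} : ℝ) / #(E k)) l (𝓝 0)}
  univ_sets := by simp [tendsto_const_nhds]
  sets_of_superset {Q R} hQ hQR := by
    refine squeeze_zero (fun k => by positivity) (fun k => ?_) hQ
    gcongr
  inter_sets {Q R} hQ hR := by
    refine squeeze_zero (fun k => by positivity) (fun k => ?_) (by simpa using hQ.add hR)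
    simp only [Set.mem_inter_iff, not_and_or, Finset.filter_or, ← add_div]
    gcongr
    exact_mod_cast Finset.card_union_le _ _

open Classical in
theorem mem_densityOneFilter {Q : Set α} :
    Q ∈ densityOneFilter E l ↔
      Tendsto (fun k => (#{g ∈ E k | g ∉ Q} : ℝ) / #(E k)) l (𝓝 0) :=
  Iff.rfl

theorem mem_densityOneFilter_of_forall_subset {Q : Set α} (hQ : ∀ k, (E k : Set α) ⊆ Q) :
    Q ∈ densityOneFilter E l := by
  classical
  have h_empty (k : ι) : {g ∈ E k | g ∉ Q} = ∅ :=
    Finset.filter_eq_empty_iff.mpr fun g hg => not_not.mpr (hQ k hg)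
  simp [mem_densityOneFilter, h_empty, tendsto_const_nhds]

open Classical in
theorem mem_densityOneFilter_iff_tendsto_one (hE : ∀ᶠ k in l, (E k).Nonempty) {Q : Set α} :
    Q ∈ densityOneFilter E l ↔
      Tendsto (fun k => (#{g ∈ E k | g ∈ Q} : ℝ) / #(E k)) l (𝓝 1) := by
  have h_compl : (fun k => 1 - (#{g ∈ E k | g ∈ Q} : ℝ) / #(E k)) =ᶠ[l]
      fun k => (#{g ∈ E k | g ∉ Q} : ℝ) / #(E k) := by
    filter_upwards [hE] with k hk
    have hcard : (#(E k) : ℝ) ≠ 0 := by exact_mod_cast hk.card_ne_zero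
    rw [one_sub_div hcard, ← Finset.card_filter_add_card_filter_not (s := E k) (· ∈ Q)]
    push_cast
    rw [add_sub_cancel_left]
  rw [mem_densityOneFilter, ← tendsto_congr' h_compl]
  constructor <;> intro h <;> simpa using h.const_sub 1

theorem neBot_densityOneFilter [l.NeBot] (hE : ∀ᶠ k in l, (E k).Nonempty) :
    (densityOneFilter E l).NeBot := by
  classical
  rw [← empty_mem_iff_bot.not.trans neBot_iff.symm, mem_densityOneFilter_iff_tendsto_one hE]
  simp

theorem densityOneFilter_le_cofinite (hE : Tendsto (fun k => #(E k)) l atTop) :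
    densityOneFilter E l ≤ cofinite := by
  classical
  intro Q hQ
  refine squeeze_zero (fun k => by positivity) (fun k => ?_)
    ((tendsto_natCast_atTop_atTop.comp hE).const_div_atTop (#(Set.Finite.toFinset hQ) : ℝ))
  simp only [Function.comp_apply]
  gcongr
  exact fun g hg => (Set.Finite.mem_toFinset _).mpr (Finset.mem_filter.mp hg).2

theorem card_filter_lt_div_card_mul_le_expect (s : Finset α) {φ : α → ℝ} (hφ : ∀ g, 0 ≤ φ g)
    (t : ℝ) : (#{g ∈ s | t < φ g} : ℝ) / #s * t ≤ 𝔼 g ∈ s, φ g := by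
  rw [Finset.expect_eq_sum_div_card, div_mul_eq_mul_div, ← nsmul_eq_mul]
  gcongr
  calc #{g ∈ s | t < φ g} • t ≤ ∑ g ∈ s with t < φ g, φ g :=
        Finset.card_nsmul_le_sum _ _ _ fun g hg => (Finset.mem_filter.mp hg).2.le
    _ ≤ ∑ g ∈ s, φ g :=
        Finset.sum_le_sum_of_subset_of_nonneg (Finset.filter_subset _ _) fun g _ _ => hφ g

/-- Koopman–von Neumann: a point `g` of `E k` is discarded when `φ g` exceeds a threshold `t k`
tending to zero more slowly than the averages of `φ`. -/
theorem exists_mem_densityOneFilter_tendsto_zero {E : ℕ → Finset α} (hE : Monotone E) {φ : α → ℝ}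
    (hφ : ∀ g, 0 ≤ φ g) (havg : Tendsto (fun k => 𝔼 g ∈ E k, φ g) atTop (𝓝 0)) :
    ∃ Q ∈ densityOneFilter E atTop,
      Q ⊆ ⋃ k, (E k : Set α) ∧ Tendsto φ (cofinite ⊓ 𝓟 Q) (𝓝 0) := by
  classical
  set r : ℕ → ℝ := fun k => 𝔼 g ∈ E k, φ g + 1 / ((k : ℝ) + 1)
  set t : ℕ → ℝ := fun k => √(r k)
  have hr_pos (k : ℕ) : 0 < r k :=
    add_pos_of_nonneg_of_pos (Finset.expect_nonneg fun g _ => hφ g) Nat.one_div_pos_of_nat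
  have ht : Tendsto t atTop (𝓝 0) := by
    simpa [t, r] using (havg.add tendsto_one_div_add_atTop_nhds_zero_nat).sqrt
  refine ⟨{g | ∃ k, g ∈ E k ∧ φ g ≤ t k}, ?_, ?_, ?_⟩
  · refine squeeze_zero (fun k => by positivity) (fun k => ?_) ht
    calc (#{g ∈ E k | g ∉ {g | ∃ k, g ∈ E k ∧ φ g ≤ t k}} : ℝ) / #(E k)
        ≤ #{g ∈ E k | t k < φ g} / #(E k) := by
          gcongr with g hg
          exact fun h => not_le.mp fun hle => h ⟨k, hg, hle⟩
      _ ≤ (𝔼 g ∈ E k, φ g) / t k := by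
          rw [le_div_iff₀ (Real.sqrt_pos.mpr (hr_pos k))]
          exact card_filter_lt_div_card_mul_le_expect _ hφ _
      _ ≤ r k / t k := by
          gcongr
          exact le_add_of_nonneg_right (by positivity)
      _ = t k := Real.div_sqrt
  · rintro g ⟨k, hgk, -⟩
    exact Set.mem_iUnion.mpr ⟨k, hgk⟩
  · refine tendsto_order.mpr ⟨fun ε hε => .of_forall fun g => hε.trans_le (hφ g), fun ε hε => ?_⟩
    obtain ⟨N, hN⟩ := eventually_atTop.mp (ht.eventually_lt_const hε)
    rw [eventually_inf_principal]
    filter_upwards [(E N).finite_toSet.compl_mem_cofinite] with g hgN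
    rintro ⟨k, hgk, hle⟩
    refine hle.trans_lt (hN k (le_of_not_ge fun hkN => hgN (hE hkN hgk)))

theorem tendsto_comap_atTop_of_forall_strictMono {β γ : Type*} [LinearOrder β] [NoMaxOrder β]
    [(atTop : Filter β).IsCountablyGenerated] {h : α → β} {φ : α → γ} {Q : Set α} {y : Filter γ}
    (H : ∀ s : ℕ → α, (∀ i, s i ∈ Q) → StrictMono (fun i => h (s i)) →
      Tendsto (fun i => φ (s i)) atTop y) :
    Tendsto φ (comap h atTop ⊓ 𝓟 Q) y := by
  refine tendsto_of_subseq_tendsto fun s hs => ?_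
  rw [tendsto_inf, tendsto_comap_iff, tendsto_principal] at hs
  obtain ⟨N, hN⟩ := eventually_atTop.mp hs.2
  obtain ⟨m, -, hm⟩ :=
    strictMono_subseq_of_tendsto_atTop ((tendsto_add_atTop_iff_nat N).mpr hs.1)
  exact ⟨fun n => m n + N, H _ (fun i => hN _ (Nat.le_add_left _ _)) hm⟩

end DensityOne

section AlmostPeriodic

theorem isCompact_closure_iff_totallyBounded {E : Type*} [UniformSpace E] [CompleteSpace E]
    {A : Set E} : IsCompact (closure A) ↔ TotallyBounded A := by
  rw [isCompact_iff_totallyBounded_isComplete, totallyBounded_closure,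
    and_iff_left isClosed_closure.isComplete]

theorem totallyBounded_of_forall_exists_dist_lt {E : Type*} [PseudoMetricSpace E] {A : Set E}
    (h : ∀ ε > 0, ∃ T : Set E, TotallyBounded T ∧ ∀ a ∈ A, ∃ t ∈ T, dist a t < ε) :
    TotallyBounded A := by
  rw [Metric.totallyBounded_iff]
  intro ε hε
  obtain ⟨T, hT, hAT⟩ := h (ε / 2) (half_pos hε)
  obtain ⟨s, hs, hcover⟩ := Metric.totallyBounded_iff.mp hT (ε / 2) (half_pos hε)
  refine ⟨s, hs, fun a ha => ?_⟩
  obtain ⟨t, ht, hat⟩ := hAT a ha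
  obtain ⟨y, hy, hty⟩ := Set.mem_iUnion₂.mp (hcover ht)
  exact Set.mem_iUnion₂.mpr ⟨y, hy, (dist_triangle a t y).trans_lt (by
    simpa using add_lt_add hat hty)⟩

theorem totallyBounded_image_of_dist_le {ι E F : Type*} [PseudoMetricSpace E]
    [PseudoMetricSpace F] {x : ι → E} {y : ι → F} {S : Set ι} {C : ℝ}
    (hC : ∀ i ∈ S, ∀ j ∈ S, dist (x i) (x j) ≤ C * dist (y i) (y j))
    (hy : TotallyBounded (y '' S)) : TotallyBounded (x '' S) := by
  rw [Metric.totallyBounded_iff]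
  intro ε hε
  obtain ⟨s, hsS, hs, hcover⟩ := Set.exists_subset_image_finite_and.mp
    (Metric.finite_approx_of_totallyBounded hy (ε / (|C| + 1)) (by positivity))
  refine ⟨x '' s, hs.image x, ?_⟩
  rintro _ ⟨i, hi, rfl⟩
  simp only [Set.biUnion_image] at hcover ⊢
  obtain ⟨j, hj, hij⟩ := Set.mem_iUnion₂.mp (hcover ⟨i, hi, rfl⟩)
  refine Set.mem_iUnion₂.mpr ⟨j, hj, ?_⟩
  calc dist (x i) (x j) ≤ C * dist (y i) (y j) := hC i hi j (hsS hj)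
    _ ≤ (|C| + 1) * dist (y i) (y j) := by gcongr; linarith [le_abs_self C]
    _ < ε := by rwa [mul_comm, ← lt_div_iff₀ (by positivity)]

variable {G 𝕜 H : Type*} [RCLike 𝕜] [NormedAddCommGroup H] [InnerProductSpace 𝕜 H]

/-- `v` is almost periodic along the index set `S` of the isometries `U g`: its partial orbit
`{U g v : g ∈ S}` is totally bounded, that is, relatively compact when `H` is complete. -/
def IsAlmostPeriodicAlong (U : G → H →ₗᵢ[𝕜] H) (S : Set G) (v : H) : Prop :=
  TotallyBounded ((fun g => U g v) '' S)

theorem isClosed_setOf_isAlmostPeriodicAlong (U : G → H →ₗᵢ[𝕜] H) (S : Set G) :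
    IsClosed {v | IsAlmostPeriodicAlong U S v} := by
  refine isClosed_of_closure_subset fun v hv => ?_
  refine totallyBounded_of_forall_exists_dist_lt fun ε hε => ?_
  obtain ⟨w, hw, hvw⟩ := Metric.mem_closure_iff.mp hv ε hε
  refine ⟨_, hw, ?_⟩
  rintro _ ⟨g, hg, rfl⟩
  exact ⟨U g w, ⟨g, hg, rfl⟩, by rwa [(U g).dist_map]⟩

theorem IsAlmostPeriodicAlong.of_translates_cover [AddCommGroup G] {U : G → H →ₗᵢ[𝕜] H}
    (hU : ∀ g h x, U (g + h) x = U g (U h x)) {S S' : Set G} {F : Set G} (hF : F.Finite)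
    (hcover : ∀ g ∈ S', ∃ f ∈ F, g - f ∈ S) {v : H} (hv : IsAlmostPeriodicAlong U S v) :
    IsAlmostPeriodicAlong U S' v := by
  refine ((totallyBounded_biUnion hF).mpr fun f _ =>
    hv.image (U f).isometry.uniformContinuous).subset ?_
  rintro _ ⟨g, hg, rfl⟩
  obtain ⟨f, hf, hgf⟩ := hcover g hg
  exact Set.mem_iUnion₂.mpr ⟨f, hf, _, ⟨g - f, hgf, rfl⟩, by rw [← hU, add_sub_cancel]⟩

theorem IsAlmostPeriodicAlong.map [AddCommGroup G] {U : G → H →ₗᵢ[𝕜] H}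
    (hU : ∀ g h x, U (g + h) x = U g (U h x)) {S : Set G} {v : H}
    (hv : IsAlmostPeriodicAlong U S v) (g : G) : IsAlmostPeriodicAlong U S (U g v) := by
  refine (hv.image (U g).isometry.uniformContinuous).subset ?_
  rintro _ ⟨h, hh, rfl⟩
  exact ⟨U h v, ⟨h, hh, rfl⟩, by simp only [← hU, add_comm]⟩

theorem inner_isometry_left [AddCommGroup G] {U : G → H →ₗᵢ[𝕜] H}
    (hU : ∀ g h x, U (g + h) x = U g (U h x)) (g : G) (x y : H) :
    ⟪U g x, y⟫_𝕜 = ⟪x, U (-g) y⟫_𝕜 := by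
  have hU_zero (x : H) : U 0 x = x := (U 0).injective (by rw [← hU, add_zero])
  rw [← (U (-g)).inner_map_map (U g x) y, ← hU, neg_add_cancel, hU_zero]

theorem eq_norm_sq_of_tendsto_inner {ι : Type*} [CompleteSpace H] {l : Filter ι} [l.NeBot]
    {x : ι → H} {S : Set ι} (hS : S ∈ l) (hx : TotallyBounded (x '' S)) {r : ℝ}
    (hr : ∀ i ∈ S, ‖x i‖ = r) {c : 𝕜}
    (hc : ∀ j ∈ S, Tendsto (fun i => inner 𝕜 (x i) (x j)) l (𝓝 c)) : c = (r : 𝕜) ^ 2 := by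
  obtain ⟨u, -, hu⟩ := (isCompact_closure_iff_totallyBounded.mpr hx).ultrafilter_le_nhds'
    ((Ultrafilter.of l).map x)
    (Filter.mem_map.mpr (Ultrafilter.of_le l (mem_of_superset hS fun i hi =>
      subset_closure ⟨i, hi, rfl⟩)))
  have hu : Tendsto x (Ultrafilter.of l) (𝓝 u) := hu
  have hS' : ∀ᶠ i in (Ultrafilter.of l : Filter ι), i ∈ S := Ultrafilter.of_le l hS
  have h_inner : ∀ j ∈ S, inner 𝕜 u (x j) = c := fun j hj =>
    tendsto_nhds_unique (hu.inner tendsto_const_nhds) ((hc j hj).mono_left (Ultrafilter.of_le l))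
  have h_inner_self : inner 𝕜 u u = c :=
    tendsto_nhds_unique (tendsto_const_nhds.inner hu)
      (tendsto_const_nhds.congr' (hS'.mono fun j hj => (h_inner j hj).symm))
  have h_norm : ‖u‖ = r :=
    tendsto_nhds_unique hu.norm (tendsto_const_nhds.congr' (hS'.mono fun j hj => (hr j hj).symm))
  rw [← h_inner_self, inner_self_eq_norm_sq_to_K, h_norm]

end AlmostPeriodic

section Hilbert

variable {𝕜 H : Type*} [RCLike 𝕜] [NormedAddCommGroup H] [InnerProductSpace 𝕜 H]

theorem exists_weak_limit_of_norm_le [CompleteSpace H] {ι : Type*} (𝒰 : Ultrafilter ι)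
    {v : ι → H} {C : ℝ} (hv : ∀ k, ‖v k‖ ≤ C) :
    ∃ w : H, ∀ y, Tendsto (fun k => ⟪v k, y⟫_𝕜) 𝒰 (𝓝 ⟪w, y⟫_𝕜) := by
  set φ : ι → WeakDual 𝕜 H := fun k =>
    StrongDual.toWeakDual (InnerProductSpace.toDual 𝕜 H (v k))
  have hφ (k : ι) : φ k ∈ WeakDual.toStrongDual ⁻¹' Metric.closedBall (0 : StrongDual 𝕜 H) C := by
    rw [Set.mem_preimage, mem_closedBall_zero_iff]
    exact ((InnerProductSpace.toDual 𝕜 H).norm_map (v k)).trans_le (hv k)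
  obtain ⟨ψ, -, hψ⟩ := (WeakDual.isCompact_closedBall 0 C).ultrafilter_le_nhds' (𝒰.map φ)
    (Filter.mem_map.mpr (univ_mem' hφ))
  refine ⟨(InnerProductSpace.toDual 𝕜 H).symm (WeakDual.toStrongDual ψ), fun y => ?_⟩
  rw [InnerProductSpace.toDual_symm_apply]
  exact ((WeakDual.eval_continuous (𝕜 := 𝕜) y).tendsto ψ).comp hψ

theorem orthonormal_insert [DecidableEq H] {s : Finset H}
    (hs : Orthonormal 𝕜 ((↑) : s → H)) {z : H}
    (hz : ‖z‖ = 1) (hsz : ∀ x ∈ s, ⟪x, z⟫_𝕜 = 0) :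
    Orthonormal 𝕜 ((↑) : ↥(insert z s) → H) := by
  refine ⟨?_, ?_⟩
  · rintro ⟨x, hx⟩
    rcases Finset.mem_insert.mp hx with rfl | hx
    · exact hz
    · exact hs.1 ⟨x, hx⟩
  · rintro ⟨x, hx⟩ ⟨y, hy⟩ hxy
    have hxy : x ≠ y := by simpa using hxy
    rcases Finset.mem_insert.mp hx with rfl | hxs <;>
      rcases Finset.mem_insert.mp hy with rfl | hys
    · exact absurd rfl hxy
    · exact inner_eq_zero_symm.mp (hsz y hys)
    · exact hsz x hxs
    · exact hs.2 (i := ⟨x, hxs⟩) (j := ⟨y, hys⟩) (by simpa using hxy)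

/-- The unit vector along the residual of `a` extends `s` to a larger orthonormal family. -/
theorem norm_sub_starProjection_sq_add_sum_le {q : H → ℝ} {K : ℝ}
    (hK : ∀ s : Finset H, Orthonormal 𝕜 ((↑) : s → H) → ∑ y ∈ s, q y ≤ K) {a : H}
    (ha : ∀ y, ‖⟪a, y⟫_𝕜‖ ^ 2 ≤ q y) {s : Finset H} (hs : Orthonormal 𝕜 ((↑) : s → H)) :
    ‖a - (Submodule.span 𝕜 (s : Set H)).starProjection a‖ ^ 2 + ∑ y ∈ s, q y ≤ K := by
  classical
  set P := Submodule.span 𝕜 (s : Set H)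
  set r := a - P.starProjection a with hr
  have hrP : r ∈ Pᗮ := P.sub_starProjection_mem_orthogonal a
  rcases eq_or_ne r 0 with h0 | h0
  · simpa [h0] using hK s hs
  set z : H := ((‖r‖⁻¹ : ℝ) : 𝕜) • r with hz
  have hz_norm : ‖z‖ = 1 := by simp [hz, norm_smul, h0]
  have hsz (x : H) (hx : x ∈ s) : ⟪x, z⟫_𝕜 = 0 := by
    rw [hz, inner_smul_right,
      (Submodule.mem_orthogonal _ _).mp hrP x (Submodule.subset_span hx), mul_zero]
  have h_inner : ⟪a, z⟫_𝕜 = (‖r‖ : 𝕜) := by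
    have h_proj : ⟪P.starProjection a, r⟫_𝕜 = 0 :=
      (Submodule.mem_orthogonal _ _).mp hrP _ (P.starProjection_apply_mem a)
    have h_self : ⟪a, r⟫_𝕜 = (‖r‖ : 𝕜) ^ 2 := by
      rw [← sub_add_cancel a (P.starProjection a), inner_add_left, ← hr, h_proj, add_zero,
        inner_self_eq_norm_sq_to_K]
    rw [hz, inner_smul_right, h_self]
    have : (‖r‖ : 𝕜) ≠ 0 := by simpa using h0
    push_cast
    field_simp
  have hzs : z ∉ s := fun hmem => by
    simpa [hz_norm] using hsz z hmem
  calc ‖r‖ ^ 2 + ∑ y ∈ s, q y ≤ q z + ∑ y ∈ s, q y := by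
        gcongr
        simpa [h_inner] using ha z
    _ = ∑ y ∈ insert z s, q y := (Finset.sum_insert hzs).symm
    _ ≤ K := hK _ (orthonormal_insert hs hz_norm hsz)

theorem totallyBounded_of_norm_inner_sq_le {q : H → ℝ} {K : ℝ}
    (hK : ∀ s : Finset H, Orthonormal 𝕜 ((↑) : s → H) → ∑ y ∈ s, q y ≤ K) {A : Set H}
    (hA : ∀ a ∈ A, ∀ y, ‖⟪a, y⟫_𝕜‖ ^ 2 ≤ q y) : TotallyBounded A := by
  set sums : Set ℝ :=
    {r | ∃ s : Finset H, Orthonormal 𝕜 ((↑) : s → H) ∧ ∑ y ∈ s, q y = r}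
  have h_bdd : BddAbove sums := ⟨K, by rintro _ ⟨s, hs, rfl⟩; exact hK s hs⟩
  have h_empty : Orthonormal 𝕜 ((↑) : (∅ : Finset H) → H) := by simp [Orthonormal]
  have h_norm (a) (ha : a ∈ A) : ‖a‖ ≤ √K := by
    refine Real.le_sqrt_of_sq_le ?_
    simpa using norm_sub_starProjection_sq_add_sum_le hK (hA a ha) h_empty
  refine totallyBounded_of_forall_exists_dist_lt fun ε hε => ?_
  obtain ⟨_, ⟨s, hs, rfl⟩, h_near⟩ := exists_lt_of_lt_csSup (s := sums) ⟨_, ∅, h_empty, rfl⟩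
    (sub_lt_self _ (sq_pos_of_pos hε))
  set P := Submodule.span 𝕜 (s : Set H)
  refine ⟨((↑) : P → H) '' Metric.closedBall 0 (√K), ?_, fun a ha => ?_⟩
  · have : ProperSpace P := FiniteDimensional.proper 𝕜 P
    exact ((isCompact_closedBall 0 _).image continuous_subtype_val).totallyBounded
  · refine ⟨P.starProjection a, ⟨P.orthogonalProjectionOnto a, ?_, rfl⟩, ?_⟩
    · rw [mem_closedBall_zero_iff]
      exact (P.norm_orthogonalProjectionOnto_apply_le a).trans (h_norm a ha)
    · have h_residual := norm_sub_starProjection_sq_add_sum_le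
        (fun t ht => le_csSup h_bdd ⟨t, ht, rfl⟩) (hA a ha) hs
      rw [dist_eq_norm]
      exact lt_of_pow_lt_pow_left₀ 2 hε.le (by linarith)

end Hilbert

section EmpiricalCovariance

variable {𝕜 H ι : Type*} [RCLike 𝕜] [NormedAddCommGroup H] [InnerProductSpace 𝕜 H]

variable (𝕜) in
/-- The covariance operator `ψ ↦ |s|⁻¹ ∑ ⟪x i, ψ⟫ x i` of the uniformly distributed family
`x i`, `i ∈ s`, applied to `ψ`. -/
noncomputable def empiricalCovariance (x : ι → H) (s : Finset ι) (ψ : H) : H :=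
  (#s : 𝕜)⁻¹ • ∑ i ∈ s, ⟪x i, ψ⟫_𝕜 • x i

variable (x : ι → H) (s : Finset ι) (ψ : H)

theorem inner_empiricalCovariance_left (y : H) :
    ⟪empiricalCovariance 𝕜 x s ψ, y⟫_𝕜 = (#s : 𝕜)⁻¹ * ∑ i ∈ s, ⟪ψ, x i⟫_𝕜 * ⟪x i, y⟫_𝕜 := by
  simp [empiricalCovariance, inner_smul_left, sum_inner]

theorem inner_empiricalCovariance_self :
    ⟪empiricalCovariance 𝕜 x s ψ, ψ⟫_𝕜 = ((𝔼 i ∈ s, ‖⟪x i, ψ⟫_𝕜‖ ^ 2 : ℝ) : 𝕜) := by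
  rw [inner_empiricalCovariance_left, Finset.expect_eq_sum_div_card]
  simp [div_eq_inv_mul, ← RCLike.conj_mul]

theorem norm_inner_empiricalCovariance_sq_le (y : H) :
    ‖⟪empiricalCovariance 𝕜 x s ψ, y⟫_𝕜‖ ^ 2 ≤
      (𝔼 i ∈ s, ‖⟪x i, ψ⟫_𝕜‖ ^ 2) * 𝔼 i ∈ s, ‖⟪x i, y⟫_𝕜‖ ^ 2 := by
  have h_expect : ‖⟪empiricalCovariance 𝕜 x s ψ, y⟫_𝕜‖ ≤
      𝔼 i ∈ s, ‖⟪x i, ψ⟫_𝕜‖ * ‖⟪x i, y⟫_𝕜‖ := by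
    rw [inner_empiricalCovariance_left, Finset.expect_eq_sum_div_card, div_eq_inv_mul, norm_mul,
      norm_inv, RCLike.norm_natCast]
    gcongr
    refine (norm_sum_le _ _).trans_eq (Finset.sum_congr rfl fun i _ => ?_)
    rw [norm_mul, norm_inner_symm]
  calc ‖⟪empiricalCovariance 𝕜 x s ψ, y⟫_𝕜‖ ^ 2
      ≤ (𝔼 i ∈ s, ‖⟪x i, ψ⟫_𝕜‖ * ‖⟪x i, y⟫_𝕜‖) ^ 2 := by gcongr
    _ ≤ _ := Finset.expect_mul_sq_le_sq_mul_sq _ _ _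

theorem expect_le_of_forall_le {φ : ι → ℝ} {K : ℝ} (hK : 0 ≤ K) (hφ : ∀ i ∈ s, φ i ≤ K) :
    𝔼 i ∈ s, φ i ≤ K := by
  rcases s.eq_empty_or_nonempty with rfl | hs
  · simpa using hK
  · exact Finset.expect_le hs hφ

variable {x}

theorem expect_norm_inner_sq_le {r : ℝ} (hx : ∀ i, ‖x i‖ ≤ r) :
    𝔼 i ∈ s, ‖⟪x i, ψ⟫_𝕜‖ ^ 2 ≤ (r * ‖ψ‖) ^ 2 := by
  refine expect_le_of_forall_le s (sq_nonneg _) fun i _ => ?_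
  gcongr
  exact (norm_inner_le_norm _ _).trans (by gcongr; exact hx i)

theorem norm_empiricalCovariance_le {r : ℝ} (hx : ∀ i, ‖x i‖ ≤ r) :
    ‖empiricalCovariance 𝕜 x s ψ‖ ≤ r ^ 2 * ‖ψ‖ := by
  set v := empiricalCovariance 𝕜 x s ψ
  have h_sq : (‖v‖ * ‖v‖) ^ 2 ≤ (r ^ 2 * ‖ψ‖ * ‖v‖) ^ 2 :=
    calc (‖v‖ * ‖v‖) ^ 2 = ‖⟪v, v⟫_𝕜‖ ^ 2 := by simp [inner_self_eq_norm_sq_to_K, sq]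
      _ ≤ (𝔼 i ∈ s, ‖⟪x i, ψ⟫_𝕜‖ ^ 2) * 𝔼 i ∈ s, ‖⟪x i, v⟫_𝕜‖ ^ 2 :=
          norm_inner_empiricalCovariance_sq_le x s ψ v
      _ ≤ (r * ‖ψ‖) ^ 2 * (r * ‖v‖) ^ 2 :=
          mul_le_mul (expect_norm_inner_sq_le s ψ hx) (expect_norm_inner_sq_le s v hx)
            (Finset.expect_nonneg fun i _ => sq_nonneg _) (sq_nonneg _)
      _ = (r ^ 2 * ‖ψ‖ * ‖v‖) ^ 2 := by ring
  rcases (norm_nonneg v).eq_or_lt with h0 | hpos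
  · rw [← h0]
    positivity
  · exact le_of_mul_le_mul_right (le_of_sq_le_sq h_sq (by positivity)) hpos

theorem sum_expect_norm_inner_sq_le {r : ℝ} (hx : ∀ i, ‖x i‖ ≤ r) {t : Finset H}
    (ht : Orthonormal 𝕜 ((↑) : t → H)) :
    ∑ y ∈ t, 𝔼 i ∈ s, ‖⟪x i, y⟫_𝕜‖ ^ 2 ≤ r ^ 2 := by
  rw [← Finset.expect_sum_comm]
  refine expect_le_of_forall_le s (sq_nonneg _) fun i _ => ?_
  calc ∑ y ∈ t, ‖⟪x i, y⟫_𝕜‖ ^ 2 = ∑ y : t, ‖⟪(y : H), x i⟫_𝕜‖ ^ 2 := by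
        simp only [norm_inner_symm (x i), Finset.sum_coe_sort t fun y => ‖⟪y, x i⟫_𝕜‖ ^ 2]
    _ ≤ ‖x i‖ ^ 2 := ht.sum_inner_products_le (x i)
    _ ≤ r ^ 2 := by gcongr; exact hx i

end EmpiricalCovariance

section Folner

variable {G ι : Type*} [AddCommGroup G] [DecidableEq G]

/-- A Følner condition for a pair of families of finite sets: up to a proportion of `E k` tending
to zero, the translate of `E k` by any element of `S` lies in `F k`, and `F k` is not much larger
than `E k`. Two families are needed because the translate of a strip leaves the strip. -/
structure IsFolnerPair (E F : ι → Finset G) (S : Set G) (l : Filter ι) : Prop where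
  exists_card_le : ∃ C : ℕ, ∀ᶠ k in l, #(F k) ≤ C * #(E k)
  tendsto_translate : ∀ h ∈ S,
    Tendsto (fun k => (#{g ∈ E k | g + h ∉ F k} : ℝ) / #(E k)) l (𝓝 0)

theorem IsFolnerPair.mono {E F : ι → Finset G} {S : Set G} {l l' : Filter ι}
    (hEF : IsFolnerPair E F S l) (hl : l' ≤ l) : IsFolnerPair E F S l' where
  exists_card_le := hEF.exists_card_le.imp fun _ hC => hC.filter_mono hl
  tendsto_translate h hh := (hEF.tendsto_translate h hh).mono_left hl

theorem expect_add_right_le {E F : Finset G} {C : ℕ} (hC : #F ≤ C * #E) {φ : G → ℝ}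
    (hφ : ∀ g, 0 ≤ φ g) {K : ℝ} (hK : ∀ g, φ g ≤ K) (h : G) :
    𝔼 g ∈ E, φ (g + h) ≤ C * 𝔼 g ∈ F, φ g + #{g ∈ E | g + h ∉ F} / #E * K := by
  rcases E.eq_empty_or_nonempty with rfl | hE
  · have := Finset.expect_nonneg (s := F) fun g _ => hφ g
    simpa using by positivity
  have h_in : ∑ g ∈ E with g + h ∈ F, φ (g + h) ≤ C * #E * 𝔼 g ∈ F, φ g :=
    calc ∑ g ∈ E with g + h ∈ F, φ (g + h)
        = ∑ g ∈ {g ∈ E | g + h ∈ F}.image (· + h), φ g :=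
          (Finset.sum_image fun _ _ _ _ => add_right_cancel).symm
      _ ≤ ∑ g ∈ F, φ g := by
          refine Finset.sum_le_sum_of_subset_of_nonneg (fun g hg => ?_) fun g _ _ => hφ g
          obtain ⟨g', hg', rfl⟩ := Finset.mem_image.mp hg
          exact (Finset.mem_filter.mp hg').2
      _ = #F * 𝔼 g ∈ F, φ g := by rw [← nsmul_eq_mul, Finset.card_smul_expect]
      _ ≤ C * #E * 𝔼 g ∈ F, φ g := by
          gcongr
          · exact Finset.expect_nonneg fun g _ => hφ g
          · exact_mod_cast hC
  have h_out : ∑ g ∈ E with g + h ∉ F, φ (g + h) ≤ #{g ∈ E | g + h ∉ F} * K := by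
    rw [← nsmul_eq_mul]
    exact Finset.sum_le_card_nsmul _ _ K fun g _ => hK _
  have hcard : (0 : ℝ) < #E := by exact_mod_cast hE.card_pos
  rw [Finset.expect_eq_sum_div_card, ← Finset.sum_filter_add_sum_filter_not E (· + h ∈ F),
    div_le_iff₀ hcard]
  calc _ ≤ C * #E * 𝔼 g ∈ F, φ g + #{g ∈ E | g + h ∉ F} * K := add_le_add h_in h_out
    _ = _ := by field_simp

variable {𝕜 H : Type*} [RCLike 𝕜] [NormedAddCommGroup H] [InnerProductSpace 𝕜 H]
  {U : G → H →ₗᵢ[𝕜] H} (hU : ∀ g h x, U (g + h) x = U g (U h x))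

include hU

variable {E F : ι → Finset G} {S : Set G}

theorem isAlmostPeriodicAlong_of_weak_limit {𝒰 : Ultrafilter ι} (hEF : IsFolnerPair E F S 𝒰)
    {f ψ w : H} (hw : ∀ y, Tendsto
      (fun k => ⟪empiricalCovariance 𝕜 (fun g => U g f) (E k) ψ, y⟫_𝕜) 𝒰 (𝓝 ⟪w, y⟫_𝕜)) :
    IsAlmostPeriodicAlong U S w := by
  obtain ⟨C, hC⟩ := hEF.exists_card_le
  have h_norm (g : G) : ‖U g f‖ ≤ ‖f‖ := ((U g).norm_map f).le
  have h_limit (y : H) :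
      ∃ q, Tendsto (fun k => 𝔼 g ∈ F k, ‖⟪U g f, y⟫_𝕜‖ ^ 2) 𝒰 (𝓝 q) := by
    obtain ⟨q, -, hq⟩ := (isCompact_Icc (a := (0 : ℝ))
      (b := (‖f‖ * ‖y‖) ^ 2)).ultrafilter_le_nhds'
        (𝒰.map fun k => 𝔼 g ∈ F k, ‖⟪U g f, y⟫_𝕜‖ ^ 2)
        (Filter.mem_map.mpr (univ_mem' fun k =>
          ⟨Finset.expect_nonneg fun g _ => sq_nonneg _, expect_norm_inner_sq_le _ _ h_norm⟩))
    exact ⟨q, hq⟩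
  choose q hq using h_limit
  set M : ℝ := (‖f‖ * ‖ψ‖) ^ 2
  refine totallyBounded_of_norm_inner_sq_le (𝕜 := 𝕜) (q := fun y => M * (C * q y))
    (K := M * (C * ‖f‖ ^ 2)) (fun s hs => ?_) ?_
  · rw [← Finset.mul_sum, ← Finset.mul_sum]
    gcongr
    exact le_of_tendsto' (tendsto_finsetSum s fun y _ => hq y) fun k =>
      sum_expect_norm_inner_sq_le _ h_norm hs
  rintro _ ⟨h, hh, rfl⟩ y
  have h_bound : Tendsto (fun k => M * (C * 𝔼 g ∈ F k, ‖⟪U g f, y⟫_𝕜‖ ^ 2 +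
      #{g ∈ E k | g + h ∉ F k} / #(E k) * (‖f‖ * ‖y‖) ^ 2)) 𝒰 (𝓝 (M * (C * q y))) := by
    simpa using (((hq y).const_mul (C : ℝ)).add
      ((hEF.tendsto_translate h hh).mul_const _)).const_mul M
  rw [inner_isometry_left hU]
  refine le_of_tendsto_of_tendsto ((hw (U (-h) y)).norm.pow 2) h_bound ?_
  filter_upwards [hC] with k hk
  refine (norm_inner_empiricalCovariance_sq_le _ _ _ _).trans
    (mul_le_mul (expect_norm_inner_sq_le _ _ h_norm) ?_
      (Finset.expect_nonneg fun g _ => sq_nonneg _) (sq_nonneg _))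
  calc 𝔼 g ∈ E k, ‖⟪U g f, U (-h) y⟫_𝕜‖ ^ 2 = 𝔼 g ∈ E k, ‖⟪U (g + h) f, y⟫_𝕜‖ ^ 2 := by
        refine Finset.expect_congr rfl fun g _ => ?_
        rw [add_comm, hU, inner_isometry_left hU h]
    _ ≤ _ := expect_add_right_le hk (fun g => sq_nonneg ‖⟪U g f, y⟫_𝕜‖) (fun g => by
        gcongr
        exact (norm_inner_le_norm _ _).trans_eq (by rw [(U g).norm_map])) h

theorem tendsto_expect_norm_inner_sq_zero [CompleteSpace H] {l : Filter ι}
    (hEF : IsFolnerPair E F S l) {f : H}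
    (hf : ∀ v, IsAlmostPeriodicAlong U S v → ⟪f, v⟫_𝕜 = 0) (ψ : H) :
    Tendsto (fun k => 𝔼 g ∈ E k, ‖⟪U g f, ψ⟫_𝕜‖ ^ 2) l (𝓝 0) := by
  rw [tendsto_iff_ultrafilter]
  intro 𝒰 h𝒰
  obtain ⟨w, hw⟩ := exists_weak_limit_of_norm_le (𝕜 := 𝕜) 𝒰 fun k =>
    norm_empiricalCovariance_le (𝕜 := 𝕜) (E k) ψ fun g => ((U g).norm_map f).le
  have hw_ap : IsAlmostPeriodicAlong U S w :=
    isAlmostPeriodicAlong_of_weak_limit hU (hEF.mono h𝒰) hw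
  have hw_orth (g : G) : ⟪U g f, w⟫_𝕜 = 0 := by
    rw [inner_isometry_left hU]
    exact hf _ (hw_ap.map hU (-g))
  have hw_zero : w = 0 := by
    refine inner_self_eq_zero.mp (tendsto_nhds_unique (hw w) (tendsto_const_nhds.congr fun k => ?_))
    simp [inner_empiricalCovariance_left, hw_orth]
  have h_lim := (hw ψ).norm
  simp only [inner_empiricalCovariance_self, hw_zero, inner_zero_left, norm_zero,
    RCLike.norm_ofReal] at h_lim
  exact h_lim.congr fun k => abs_of_nonneg (Finset.expect_nonneg fun g _ => sq_nonneg _)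

end Folner

section Strip

variable {β b : ℝ}

theorem mem_directionStrip_iff_abs {p : ℤ × ℤ} :
    p ∈ directionStrip β b ↔ |(p.2 : ℝ) - β * p.1| ≤ b / 2 := by
  rw [abs_sub_le_iff, directionStrip, Set.mem_ofPred_eq]
  constructor <;> rintro ⟨h₁, h₂⟩ <;> constructor <;> linarith

theorem add_mem_directionStrip {c : ℝ} {p q : ℤ × ℤ} (hp : p ∈ directionStrip β b)
    (hq : q ∈ directionStrip β c) : p + q ∈ directionStrip β (b + c) := by
  simp only [directionStrip, Set.mem_ofPred_eq, Prod.fst_add, Prod.snd_add, Int.cast_add] at *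
  constructor <;> linarith

theorem exists_finite_translates_cover_directionStrip (β b : ℝ) {a : ℝ} (ha : 0 < a) :
    ∃ F : Set (ℤ × ℤ), F.Finite ∧
      ∀ p ∈ directionStrip β b, ∃ f ∈ F, p - f ∈ directionStrip β a := by
  have h_bdd : TotallyBounded
      ((fun p : ℤ × ℤ => (p.2 : ℝ) - β * p.1) '' directionStrip β b) := by
    refine (isCompact_closedBall (0 : ℝ) (b / 2)).totallyBounded.subset ?_
    rintro _ ⟨p, hp, rfl⟩
    exact mem_closedBall_zero_iff.mpr (mem_directionStrip_iff_abs.mp hp)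
  obtain ⟨F, -, hF, hcover⟩ := Set.exists_subset_image_finite_and.mp
    (Metric.finite_approx_of_totallyBounded h_bdd (a / 2) (half_pos ha))
  refine ⟨F, hF, fun p hp => ?_⟩
  rw [Set.image_subset_iff] at hcover
  have hp_near := hcover hp
  simp only [Set.mem_preimage, Set.biUnion_image, Set.mem_iUnion₂] at hp_near
  obtain ⟨f, hf, hpf⟩ := hp_near
  refine ⟨f, hf, mem_directionStrip_iff_abs.mpr ?_⟩
  have h_sub : ((p - f).2 : ℝ) - β * (p - f).1 = (p.2 - β * p.1) - (f.2 - β * f.1) := by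
    simp only [Prod.fst_sub, Prod.snd_sub, Int.cast_sub]
    ring
  rw [h_sub]
  exact (Metric.mem_ball.mp hpf).le

theorem card_Icc_ceil_floor_le (x y : ℝ) : #(Finset.Icc ⌈x⌉ ⌊y⌋) ≤ ⌊y - x⌋₊ + 1 := by
  have h_floor : ⌊y⌋ - ⌈x⌉ ≤ ⌊y - x⌋ :=
    Int.le_floor.mpr (by push_cast; linarith [Int.floor_le y, Int.le_ceil x])
  rw [Int.card_Icc, ← Int.floor_toNat]
  omega

theorem card_le_mul_card_of_fst_mem {P : Finset (ℤ × ℤ)}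
    (hP : (P : Set (ℤ × ℤ)) ⊆ directionStrip β b) {T : Finset ℤ} (hT : ∀ p ∈ P, p.1 ∈ T) :
    #P ≤ (⌊b⌋₊ + 1) * #T := by
  refine Finset.card_le_mul_card_image_of_maps_to hT _ fun m _ => ?_
  calc #{p ∈ P | p.1 = m} ≤ #(Finset.Icc ⌈β * m - b / 2⌉ ⌊β * m + b / 2⌋) := by
        refine Finset.card_le_card_of_injOn Prod.snd (fun p hp => ?_) fun p hp q hq h => ?_
        · obtain ⟨hpP, rfl⟩ := Finset.mem_filter.mp hp
          have hp_strip := hP hpP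
          exact Finset.mem_Icc.mpr ⟨Int.ceil_le.mpr hp_strip.1, Int.le_floor.mpr hp_strip.2⟩
        · exact Prod.ext ((Finset.mem_filter.mp hp).2.trans (Finset.mem_filter.mp hq).2.symm) h
    _ ≤ ⌊b⌋₊ + 1 := by
        have := card_Icc_ceil_floor_le (β * m - b / 2) (β * m + b / 2)
        rwa [show β * m + b / 2 - (β * m - b / 2) = b by ring] at this

/-- `Λ_k^v(b)` as a `Finset`. -/
noncomputable def truncatedStrip (β b : ℝ) (k : ℕ) : Finset (ℤ × ℤ) :=
  (directionStripTrunc_finite β b k).toFinset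

theorem mem_truncatedStrip {k : ℕ} {p : ℤ × ℤ} :
    p ∈ truncatedStrip β b k ↔ p ∈ directionStrip β b ∧ p.1 ∈ Finset.Ico 0 (k : ℤ) := by
  simp only [truncatedStrip, Set.Finite.mem_toFinset, directionStripTrunc, verticalBand,
    Set.mem_inter_iff, Set.mem_ofPred_eq, Finset.mem_Ico, Int.le_sub_one_iff]

theorem coe_truncatedStrip_subset (β b : ℝ) (k : ℕ) :
    (truncatedStrip β b k : Set (ℤ × ℤ)) ⊆ directionStrip β b :=
  fun _ hp => (mem_truncatedStrip.mp hp).1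

theorem monotone_truncatedStrip (β b : ℝ) : Monotone (truncatedStrip β b) := by
  intro j k hjk p
  simp only [mem_truncatedStrip]
  exact And.imp_right fun hp => Finset.Ico_subset_Ico_right (by exact_mod_cast hjk) hp

theorem truncatedStrip_nonempty (β : ℝ) (hb : 0 ≤ b) {k : ℕ} (hk : 0 < k) :
    (truncatedStrip β b k).Nonempty :=
  ⟨0, mem_truncatedStrip.mpr
    ⟨mem_directionStrip_iff_abs.mpr (by simpa using div_nonneg hb two_pos.le), by simpa using hk⟩⟩

theorem card_filter_fst_add_notMem_Ico_le (β b : ℝ) (k : ℕ) (h : ℤ) :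
    #{p ∈ truncatedStrip β b k | p.1 + h ∉ Finset.Ico 0 (k : ℤ)} ≤
      (⌊b⌋₊ + 1) * h.natAbs := by
  set T : Finset ℤ := Finset.Ico 0 (-h) ∪ Finset.Ico (k - h) k
  have hT : #T ≤ h.natAbs := (Finset.card_union_le _ _).trans (by simp only [Int.card_Ico]; omega)
  refine (card_le_mul_card_of_fst_mem (β := β) (T := T) ?_ fun p hp => ?_).trans
    (Nat.mul_le_mul_left _ hT)
  · exact fun p hp => coe_truncatedStrip_subset β b k (Finset.filter_subset _ _ hp)
  · simp only [Finset.mem_filter, mem_truncatedStrip, Finset.mem_Ico, T, Finset.mem_union] at hp ⊢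
    omega

theorem exists_card_truncatedStrip_le_mul (β b : ℝ) {a : ℝ} (ha : 0 < a) :
    ∃ C : ℕ, ∀ k, #(truncatedStrip β b k) ≤ C * #(truncatedStrip β a k) := by
  classical
  obtain ⟨F, hF, hcover⟩ := exists_finite_translates_cover_directionStrip β b ha
  lift F to Finset (ℤ × ℤ) using hF
  set D : ℕ := ∑ f ∈ F, (⌊b⌋₊ + 1) * (-f.1).natAbs
  refine ⟨#F + D, fun k => ?_⟩
  rcases k.eq_zero_or_pos with rfl | hk
  · have h_empty : truncatedStrip β b 0 = ∅ :=
      Finset.eq_empty_of_forall_notMem fun p hp => by simpa using (mem_truncatedStrip.mp hp).2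
    simp [h_empty]
  have h_subset : truncatedStrip β b k ⊆ F.biUnion fun f => (truncatedStrip β a k).image (· + f) ∪
      {p ∈ truncatedStrip β b k | p.1 + -f.1 ∉ Finset.Ico 0 (k : ℤ)} := by
    intro p hp
    obtain ⟨f, hf, hpf⟩ := hcover p (mem_truncatedStrip.mp hp).1
    refine Finset.mem_biUnion.mpr ⟨f, hf, ?_⟩
    by_cases h_band : p.1 + -f.1 ∈ Finset.Ico 0 (k : ℤ)
    · exact Finset.mem_union_left _ (Finset.mem_image.mpr
        ⟨p - f, mem_truncatedStrip.mpr ⟨hpf, h_band⟩, sub_add_cancel p f⟩)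
    · exact Finset.mem_union_right _ (Finset.mem_filter.mpr ⟨hp, h_band⟩)
  calc #(truncatedStrip β b k)
      ≤ ∑ f ∈ F, (#(truncatedStrip β a k) + (⌊b⌋₊ + 1) * (-f.1).natAbs) :=
        ((Finset.card_le_card h_subset).trans Finset.card_biUnion_le).trans
          (Finset.sum_le_sum fun f _ => (Finset.card_union_le _ _).trans
            (add_le_add Finset.card_image_le (card_filter_fst_add_notMem_Ico_le β b k _)))
    _ = #F * #(truncatedStrip β a k) + D := by
        rw [Finset.sum_add_distrib, Finset.sum_const, smul_eq_mul]
    _ ≤ (#F + D) * #(truncatedStrip β a k) := by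
        rw [add_mul]
        gcongr
        exact Nat.le_mul_of_pos_right D (truncatedStrip_nonempty β ha.le hk).card_pos

theorem le_card_truncatedStrip_one (β : ℝ) (k : ℕ) : k ≤ #(truncatedStrip β 1 k) := by
  calc k = #(Finset.Ico 0 (k : ℤ)) := by simp
    _ ≤ #(truncatedStrip β 1 k) := by
        refine Finset.card_le_card_of_injOn (fun m => (m, round (β * m))) (fun m hm => ?_)
          fun m _ m' _ h => (Prod.mk.inj h).1
        refine mem_truncatedStrip.mpr ⟨mem_directionStrip_iff_abs.mpr ?_, hm⟩
        rw [abs_sub_comm]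
        exact abs_sub_round (β * m)

theorem tendsto_card_truncatedStrip (β : ℝ) (hb : 0 < b) :
    Tendsto (fun k => #(truncatedStrip β b k)) atTop atTop := by
  obtain ⟨C, hC⟩ := exists_card_truncatedStrip_le_mul β 1 hb
  refine tendsto_atTop.mpr fun M => ?_
  filter_upwards [eventually_gt_atTop (C * M)] with k hk
  exact (Nat.lt_of_mul_lt_mul_left
    (hk.trans_le ((le_card_truncatedStrip_one β k).trans (hC k)))).le

theorem isFolnerPair_truncatedStrip (β : ℝ) (hb : 0 < b) (c : ℝ) :
    IsFolnerPair (truncatedStrip β b) (truncatedStrip β (b + c)) (directionStrip β c) atTop where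
  exists_card_le :=
    (exists_card_truncatedStrip_le_mul β (b + c) hb).imp fun _ hC => .of_forall hC
  tendsto_translate h hh := by
    refine squeeze_zero (fun k => by positivity) (fun k => ?_)
      ((tendsto_natCast_atTop_atTop.comp (tendsto_card_truncatedStrip β hb)).const_div_atTop
        (((⌊b⌋₊ + 1) * h.1.natAbs : ℕ) : ℝ))
    simp only [Function.comp_apply]
    gcongr
    refine (Finset.card_le_card fun p hp => ?_).trans
      (card_filter_fst_add_notMem_Ico_le β b k h.1)
    obtain ⟨hpE, hpF⟩ := Finset.mem_filter.mp hp
    exact Finset.mem_filter.mpr ⟨hpE, fun h_band => hpF (mem_truncatedStrip.mpr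
      ⟨add_mem_directionStrip (mem_truncatedStrip.mp hpE).1 hh, h_band⟩)⟩

theorem hasStripDensityOne_iff_mem_densityOneFilter (hb : 0 ≤ b) {Q : Set (ℤ × ℤ)}
    (hQ : Q ⊆ directionStrip β b) :
    HasStripDensityOne β b Q ↔ Q ∈ densityOneFilter (truncatedStrip β b) atTop := by
  classical
  have h_inter (k : ℕ) :
      Q ∩ verticalBand k = ({p ∈ truncatedStrip β b k | p ∈ Q} : Finset (ℤ × ℤ)) := by
    ext p
    have : p ∈ Q → p ∈ directionStrip β b := @hQ p
    simp only [truncatedStrip, directionStripTrunc, Finset.coe_filter, Set.Finite.mem_toFinset,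
      Set.mem_inter_iff, Set.mem_ofPred_eq]
    tauto
  have h_nonempty : ∀ᶠ k in atTop, (truncatedStrip β b k).Nonempty :=
    (eventually_gt_atTop 0).mono fun _ hk => truncatedStrip_nonempty β hb hk
  simp only [HasStripDensityOne, mem_densityOneFilter_iff_tendsto_one h_nonempty, h_inter,
    Set.ncard_coe_finset, Set.ncard_eq_toFinset_card _ (directionStripTrunc_finite β b _),
    truncatedStrip]

theorem tendsto_fst_densityOneFilter_truncatedStrip (β : ℝ) (hb : 0 < b) :
    Tendsto Prod.fst (densityOneFilter (truncatedStrip β b) atTop) atTop := by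
  refine tendsto_atTop.mpr fun M => ?_
  have h_half : {p : ℤ × ℤ | p ∈ directionStrip β b ∧ 0 ≤ p.1} ∈
      densityOneFilter (truncatedStrip β b) atTop :=
    mem_densityOneFilter_of_forall_subset fun k p hp =>
      (mem_truncatedStrip.mp hp).imp_right fun hp => (Finset.mem_Ico.mp hp).1
  filter_upwards [h_half, densityOneFilter_le_cofinite (tendsto_card_truncatedStrip β hb)
    (truncatedStrip β b M.toNat).finite_toSet.compl_mem_cofinite] with p ⟨hp, hp₀⟩ hpM
  by_contra! h_lt
  exact hpM (mem_truncatedStrip.mpr ⟨hp, Finset.mem_Ico.mpr ⟨hp₀, by omega⟩⟩)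

end Strip

section Koopman

theorem tendsto_toLp_of_norm_le {α E : Type*} [MeasurableSpace α] {μ : Measure α}
    [IsFiniteMeasure μ] [NormedAddCommGroup E] {p : ENNReal} [Fact (1 ≤ p)] (hp : p ≠ ⊤)
    {f : ℕ → α → E} {g : α → E} (hf : ∀ n, MemLp (f n) p μ) (hg : MemLp g p μ) {C : ℝ}
    (hC : ∀ n x, ‖f n x‖ ≤ C) (hfg : ∀ x, Tendsto (fun n => f n x) atTop (𝓝 (g x))) :
    Tendsto (fun n => (hf n).toLp (f n)) atTop (𝓝 (hg.toLp g)) := by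
  refine (Lp.tendsto_Lp_iff_tendsto_eLpNorm'' f hf g hg).mpr ?_
  refine tendsto_Lp_finite_of_tendsto_ae Fact.out hp (fun n => (hf n).aestronglyMeasurable) hg
    (unifIntegrable_of Fact.out hp (fun n => (hf n).aestronglyMeasurable) fun ε _ => ?_)
    (ae_of_all _ hfg)
  refine ⟨(C + 1).toNNReal, fun n => ?_⟩
  have h_empty : {x | (C + 1).toNNReal ≤ ‖f n x‖₊} = ∅ := by
    refine Set.eq_empty_of_forall_notMem fun x hx => ?_
    have h_le : C + 1 ≤ ‖f n x‖ := Real.toNNReal_le_iff_le_coe.mp hx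
    linarith [hC n x]
  simp [h_empty]

/-- The orthogonal projection `1_B - μ(B)` of the indicator of `B` to the complement of the
constants in `L²(X, μ)`. -/
noncomputable def centeredIndicator {X : Type*} [MeasurableSpace X] (μ : Measure X)
    [IsFiniteMeasure μ] {B : Set X} (hB : MeasurableSet B) : Lp ℂ 2 μ :=
  indicatorConstLp 2 hB (measure_ne_top μ B) 1 - Lp.const 2 μ (μ.real B : ℂ)

theorem inner_centeredIndicator_const {X : Type*} [MeasurableSpace X] {μ : Measure X}
    [IsProbabilityMeasure μ] {B : Set X} (hB : MeasurableSet B) (c : ℂ) :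
    ⟪centeredIndicator μ hB, Lp.const 2 μ c⟫_ℂ = 0 := by
  rw [centeredIndicator, ← indicatorConstLp_univ, ← indicatorConstLp_univ, inner_sub_left,
    L2.inner_indicatorConstLp_indicatorConstLp, L2.inner_indicatorConstLp_indicatorConstLp]
  simp [mul_comm]

theorem ae_eq_empty_or_ae_eq_univ_of_measureReal_mul_self {X : Type*}
    [MeasurableSpace X] {μ : Measure X} [IsProbabilityMeasure μ] {B : Set X} (hB : MeasurableSet B)
    (h : μ.real B * μ.real B = μ.real B) :
    B =ᵐ[μ] (∅ : Set X) ∨ B =ᵐ[μ] (Set.univ : Set X) := by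
  rcases IsIdempotentElem.iff_eq_zero_or_one.mp h with h_zero | h_one
  · exact .inl (ae_eq_empty.mpr ((measureReal_eq_zero_iff).mp h_zero))
  · refine .inr (ae_eq_univ.mpr ((measureReal_eq_zero_iff).mp ?_))
    rw [probReal_compl_eq_one_sub hB, h_one, sub_self]

theorem tendsto_measureReal_densityOneFilter_of_mixesAlong {X : Type*} [MeasurableSpace X]
    [AddAction (ℤ × ℤ) X] {μ : Measure X} {β b : ℝ} {B C : Set X} (hb : 0 < b) {Q : Set (ℤ × ℤ)}
    (hQ : Q ⊆ directionStrip β b) (hQ_density : HasStripDensityOne β b Q)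
    (hmix : ∀ s : ℕ → ℤ × ℤ, (∀ i, s i ∈ Q) → StrictMono (fun i => (s i).1) →
      MixesAlong μ B C s) :
    Tendsto (fun g : ℤ × ℤ => μ.real ((fun x => g +ᵥ x) ⁻¹' B ∩ C))
      (densityOneFilter (truncatedStrip β b) atTop) (𝓝 (μ.real B * μ.real C)) :=
  (tendsto_comap_atTop_of_forall_strictMono hmix).mono_left <| le_inf
    (tendsto_iff_comap.mp (tendsto_fst_densityOneFilter_truncatedStrip β hb))
    (le_principal_iff.mpr ((hasStripDensityOne_iff_mem_densityOneFilter hb.le hQ).mp hQ_density))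

variable {X : Type*} [MeasurableSpace X] [AddAction (ℤ × ℤ) X] [MeasurableConstVAdd (ℤ × ℤ) X]
  {μ : Measure X} [VAddInvariantMeasure (ℤ × ℤ) X μ]

theorem coeFn_koopman (g : ℤ × ℤ) (v : Lp ℂ 2 μ) :
    koopman μ g v =ᵐ[μ] fun x => v (g +ᵥ x) :=
  Lp.coeFn_compMeasurePreserving v (measurePreserving_vadd g μ)

theorem koopman_add (g h : ℤ × ℤ) (v : Lp ℂ 2 μ) :
    koopman μ (g + h) v = koopman μ g (koopman μ h v) := by
  refine Lp.ext ?_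
  filter_upwards [coeFn_koopman (g + h) v, coeFn_koopman g (koopman μ h v),
    (measurePreserving_vadd g μ).quasiMeasurePreserving.ae_eq_comp (coeFn_koopman h v)]
    with x h_left h_right h_comp
  rw [h_left, h_right, add_comm, add_vadd]
  exact h_comp.symm

theorem IsAlmostPeriodicAlong.of_lipschitz_comp {S : Set (ℤ × ℤ)} {v w : Lp ℂ 2 μ}
    (hv : IsAlmostPeriodicAlong (koopman μ) S v) {φ : ℂ → ℂ} {K : NNReal}
    (hφ : LipschitzWith K φ) (hw : w =ᵐ[μ] φ ∘ v) :
    IsAlmostPeriodicAlong (koopman μ) S w := by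
  have h_comp (g : ℤ × ℤ) : koopman μ g w =ᵐ[μ] fun x => φ (koopman μ g v x) := by
    filter_upwards [coeFn_koopman g w, coeFn_koopman g v,
      (measurePreserving_vadd g μ).quasiMeasurePreserving.ae_eq_comp hw] with x hwx hvx hwvx
    rw [hwx, hvx]
    exact hwvx
  refine totallyBounded_image_of_dist_le (C := K) (fun g _ h _ => ?_) hv
  rw [dist_eq_norm, dist_eq_norm]
  refine Lp.norm_le_mul_norm_of_ae_le_mul ?_
  filter_upwards [Lp.coeFn_sub (koopman μ g w) (koopman μ h w),
    Lp.coeFn_sub (koopman μ g v) (koopman μ h v), h_comp g, h_comp h] with x hw_sub hv_sub hg hh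
  rw [hw_sub, hv_sub, Pi.sub_apply, Pi.sub_apply, hg, hh]
  exact hφ.norm_sub_le _ _

section IsFiniteMeasure

variable [IsFiniteMeasure μ] {β b : ℝ}

theorem mem_directionalKronecker_iff {B : Set X} (hB : MeasurableSet B) :
    B ∈ directionalKronecker μ β b ↔ IsAlmostPeriodicAlong (koopman μ) (directionStrip β b)
      (indicatorConstLp 2 hB (measure_ne_top μ B) (1 : ℂ)) := by
  rw [IsAlmostPeriodicAlong, ← isCompact_closure_iff_totallyBounded]
  exact exists_prop_of_true hB

theorem directionalKronecker_subset {a : ℝ} (ha : 0 < a) (b : ℝ) :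
    directionalKronecker μ β a ⊆ directionalKronecker μ β b := by
  rintro B hB
  obtain ⟨F, hF, hcover⟩ := exists_finite_translates_cover_directionStrip β b ha
  have hB_meas : MeasurableSet B := hB.fst
  rw [mem_directionalKronecker_iff hB_meas] at hB ⊢
  exact hB.of_translates_cover koopman_add hF hcover

theorem preimage_mem_directionalKronecker {v : Lp ℂ 2 μ}
    (hv : IsAlmostPeriodicAlong (koopman μ) (directionStrip β b) v) {F : Set ℂ}
    (hF : IsClosed F) : v ⁻¹' F ∈ directionalKronecker μ β b := by
  have hv_meas : Measurable v := (Lp.stronglyMeasurable v).measurable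
  have hB : MeasurableSet (v ⁻¹' F) := hv_meas hF.measurableSet
  set δ : ℕ → ℝ := fun n => 1 / ((n : ℝ) + 1)
  have hδ (n : ℕ) : 0 < δ n := Nat.one_div_pos_of_nat
  set φ : ℕ → ℂ → ℂ := fun n z => ((thickenedIndicator (hδ n) F z : ℝ) : ℂ)
  have hφ_lipschitz (n : ℕ) : LipschitzWith (δ n).toNNReal⁻¹ (φ n) := by
    have h := Complex.isometry_ofReal.lipschitz.comp
      (NNReal.isometry_coe.lipschitz.comp (lipschitzWith_thickenedIndicator (hδ n) F))
    rwa [one_mul, one_mul] at h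
  have hφ_le (n : ℕ) (z : ℂ) : ‖φ n z‖ ≤ 1 := by
    simpa [φ] using thickenedIndicator_le_one (hδ n) F z
  have hφ_tendsto (z : ℂ) :
      Tendsto (fun n => φ n z) atTop (𝓝 (F.indicator (fun _ => 1) z)) := by
    have h_lim := tendsto_pi_nhds.mp (thickenedIndicator_tendsto_indicator_closure hδ
      tendsto_one_div_add_atTop_nhds_zero_nat F) z
    rw [hF.closure_eq] at h_lim
    convert! (Complex.continuous_ofReal.comp NNReal.continuous_coe).tendsto _ |>.comp h_lim using 2
    by_cases hz : z ∈ F <;> simp [hz]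
  have hφ_memLp (n : ℕ) : MemLp (φ n ∘ v) 2 μ :=
    .of_bound ((hφ_lipschitz n).continuous.measurable.comp hv_meas).aestronglyMeasurable 1
      (ae_of_all _ fun x => hφ_le n (v x))
  refine (mem_directionalKronecker_iff hB).mpr
    ((isClosed_setOf_isAlmostPeriodicAlong _ _).mem_of_tendsto
      (tendsto_toLp_of_norm_le (by simp) hφ_memLp
        (memLp_indicator_const 2 hB 1 (.inr (measure_ne_top μ _)))
        (fun n x => hφ_le n (v x)) fun x => hφ_tendsto (v x))
      (.of_forall fun n => hv.of_lipschitz_comp (hφ_lipschitz n) (hφ_memLp n).coeFn_toLp))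

theorem IsDirectionalWeakMixing.exists_eq_const {a : ℝ} (hb : 0 < b)
    (hmix : IsDirectionalWeakMixing μ β a) {v : Lp ℂ 2 μ}
    (hv : IsAlmostPeriodicAlong (koopman μ) (directionStrip β b) v) :
    ∃ c : ℂ, v = Lp.const 2 μ c := by
  obtain ⟨c, hc⟩ : ∃ c : ℂ, v =ᵐ[μ] Function.const X c := by
    refine exists_eventuallyEq_const_of_forall_separating IsClosed fun F hF => ?_
    rcases hmix _ (directionalKronecker_subset hb a (preimage_mem_directionalKronecker hv hF))
      with h_null | h_full
    · exact .inr (eventuallyEq_empty.mp h_null)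
    · exact .inl (eventuallyEq_univ.mp h_full)
  exact ⟨c, Lp.ext (hc.trans (Lp.coeFn_const 2 μ c).symm)⟩

end IsFiniteMeasure

section IsProbabilityMeasure

variable [IsProbabilityMeasure μ] {β b : ℝ} {B C : Set X}

theorem inner_koopman_centeredIndicator (hB : MeasurableSet B) (hC : MeasurableSet C)
    (g : ℤ × ℤ) :
    ⟪koopman μ g (centeredIndicator μ hB), indicatorConstLp 2 hC (measure_ne_top μ C) 1⟫_ℂ =
      ((μ.real ((fun x => g +ᵥ x) ⁻¹' B ∩ C) - μ.real B * μ.real C : ℝ) : ℂ) := by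
  have h_koopman : koopman μ g (centeredIndicator μ hB) =
      indicatorConstLp 2 (hB.preimage (measurable_const_vadd g)) (measure_ne_top μ _) 1 -
        Lp.const 2 μ (μ.real B : ℂ) :=
    map_sub (koopman μ g) _ _
  rw [h_koopman, ← indicatorConstLp_univ, inner_sub_left,
    L2.inner_indicatorConstLp_indicatorConstLp, L2.inner_indicatorConstLp_indicatorConstLp]
  simp [mul_comm]

theorem IsDirectionalWeakMixing.tendsto_expect_sq {a : ℝ} (hmix : IsDirectionalWeakMixing μ β a)
    (hb : 0 < b) (hB : MeasurableSet B) (hC : MeasurableSet C) :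
    Tendsto (fun k => 𝔼 g ∈ truncatedStrip β b k,
      (μ.real ((fun x => g +ᵥ x) ⁻¹' B ∩ C) - μ.real B * μ.real C) ^ 2) atTop (𝓝 0) := by
  have h_orth (v : Lp ℂ 2 μ) (hv : IsAlmostPeriodicAlong (koopman μ) (directionStrip β b) v) :
      ⟪centeredIndicator μ hB, v⟫_ℂ = 0 := by
    obtain ⟨c, rfl⟩ := hmix.exists_eq_const hb hv
    exact inner_centeredIndicator_const hB c
  simpa only [inner_koopman_centeredIndicator hB hC, Complex.norm_real, Real.norm_eq_abs,
    sq_abs] using tendsto_expect_norm_inner_sq_zero koopman_add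
      (isFolnerPair_truncatedStrip β hb b) h_orth (indicatorConstLp 2 hC (measure_ne_top μ C) 1)

theorem IsDirectionalWeakMixing.exists_mixesAlong_of_injective {a : ℝ}
    (hmix : IsDirectionalWeakMixing μ β a) (hb : 0 < b) (hB : MeasurableSet B)
    (hC : MeasurableSet C) :
    ∃ Q ⊆ directionStrip β b, HasStripDensityOne β b Q ∧
      ∀ s : ℕ → ℤ × ℤ, (∀ i, s i ∈ Q) → Function.Injective s → MixesAlong μ B C s := by
  obtain ⟨Q, hQ_density, hQ, hQ_tendsto⟩ := exists_mem_densityOneFilter_tendsto_zero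
    (monotone_truncatedStrip β b) (fun g => sq_nonneg _) (hmix.tendsto_expect_sq hb hB hC)
  have hQ_strip : Q ⊆ directionStrip β b :=
    hQ.trans (Set.iUnion_subset (coe_truncatedStrip_subset β b))
  refine ⟨Q, hQ_strip, (hasStripDensityOne_iff_mem_densityOneFilter hb.le hQ_strip).mpr hQ_density,
    fun s hs h_inj => ?_⟩
  have hs_tendsto : Tendsto s atTop (cofinite ⊓ 𝓟 Q) :=
    tendsto_inf.mpr ⟨Nat.cofinite_eq_atTop ▸ h_inj.tendsto_cofinite,
      tendsto_principal.mpr (.of_forall hs)⟩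
  have h_abs := (hQ_tendsto.comp hs_tendsto).sqrt
  simp only [Function.comp_apply, Real.sqrt_sq_eq_abs, Real.sqrt_zero] at h_abs
  exact tendsto_sub_nhds_zero_iff.mp ((tendsto_zero_iff_abs_tendsto_zero _).mpr h_abs)

theorem measureReal_mul_self_of_mem_directionalKronecker (hb : 0 < b)
    (hB : B ∈ directionalKronecker μ β b)
    (hmix : ∀ C, MeasurableSet C →
      Tendsto (fun g : ℤ × ℤ => μ.real ((fun x => g +ᵥ x) ⁻¹' B ∩ C))
        (densityOneFilter (truncatedStrip β b) atTop) (𝓝 (μ.real B * μ.real C))) :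
    μ.real B * μ.real B = μ.real B := by
  have hB_meas : MeasurableSet B := hB.fst
  have h_preimage (g : ℤ × ℤ) : MeasurableSet ((fun x => g +ᵥ x) ⁻¹' B) :=
    hB_meas.preimage (measurable_const_vadd g)
  set f : Lp ℂ 2 μ := indicatorConstLp 2 hB_meas (measure_ne_top μ B) 1
  have hf_norm : ((‖f‖ : ℝ) : ℂ) ^ 2 = μ.real B := by
    refine (inner_self_eq_norm_sq_to_K (𝕜 := ℂ) f).symm.trans
      ((L2.inner_indicatorConstLp_one_indicatorConstLp_one hB_meas hB_meas).trans ?_)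
    rw [Set.inter_self]
    rfl
  have h_inner (g h : ℤ × ℤ) : ⟪koopman μ g f, koopman μ h f⟫_ℂ =
      μ.real ((fun x => g +ᵥ x) ⁻¹' B ∩ (fun x => h +ᵥ x) ⁻¹' B) := by
    exact L2.inner_indicatorConstLp_one_indicatorConstLp_one (h_preimage g) (h_preimage h)
  have h_neBot : (densityOneFilter (truncatedStrip β b) atTop).NeBot :=
    neBot_densityOneFilter ((eventually_gt_atTop 0).mono fun _ => truncatedStrip_nonempty β hb.le)
  have h_limit (h : ℤ × ℤ) : Tendsto (fun g => ⟪koopman μ g f, koopman μ h f⟫_ℂ)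
      (densityOneFilter (truncatedStrip β b) atTop) (𝓝 ((μ.real B * μ.real B : ℝ) : ℂ)) := by
    have h_mix := hmix _ (h_preimage h)
    rw [(measurePreserving_vadd h μ).measureReal_preimage hB_meas.nullMeasurableSet] at h_mix
    simp only [h_inner]
    exact (Complex.continuous_ofReal.tendsto _).comp h_mix
  have h_eq := eq_norm_sq_of_tendsto_inner (x := fun g => koopman μ g f)
    (mem_densityOneFilter_of_forall_subset (coe_truncatedStrip_subset β b))
    ((mem_directionalKronecker_iff hB_meas).mp hB) (fun g _ => (koopman μ g).norm_map f)
    (fun h _ => h_limit h)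
  exact Complex.ofReal_injective (h_eq.trans hf_norm)

end IsProbabilityMeasure

end Koopman

theorem mainTheorem9_general {X : Type*} [MeasurableSpace X] [AddAction (ℤ × ℤ) X]
    [MeasurableConstVAdd (ℤ × ℤ) X] (μ : Measure X) [IsProbabilityMeasure μ]
    [VAddInvariantMeasure (ℤ × ℤ) X μ] (β : ℝ) (a b : ℝ) (ha : 0 < a) (hb : 0 < b) :
    List.TFAE [
      IsDirectionalWeakMixing μ β a,
      ∀ B C : Set X, MeasurableSet B → MeasurableSet C →
        ∃ Q ⊆ directionStrip β b, HasStripDensityOne β b Q ∧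
          ∀ s : ℕ → ℤ × ℤ, (∀ i, s i ∈ Q) → StrictMono (fun i => (s i).1) →
            MixesAlong μ B C s,
      ∀ B C : Set X, MeasurableSet B → MeasurableSet C →
        ∃ Q ⊆ directionStrip β b, HasStripDensityOne β b Q ∧
          ∀ s : ℕ → ℤ × ℤ, (∀ i, s i ∈ Q) → Function.Injective s →
            MixesAlong μ B C s] := by
  tfae_have 1 → 3 := fun hmix B C hB hC => hmix.exists_mixesAlong_of_injective hb hB hC
  tfae_have 3 → 2 := fun h B C hB hC => by
    obtain ⟨Q, hQ, hQ_density, hQ_mix⟩ := h B C hB hC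
    exact ⟨Q, hQ, hQ_density, fun s hs hmono =>
      hQ_mix s hs (Function.Injective.of_comp (f := Prod.fst) hmono.injective)⟩
  tfae_have 2 → 1 := fun h B hB => by
    have hB_meas : MeasurableSet B := hB.fst
    refine ae_eq_empty_or_ae_eq_univ_of_measureReal_mul_self hB_meas
      (measureReal_mul_self_of_mem_directionalKronecker hb (directionalKronecker_subset ha b hB)
        fun C hC => ?_)
    obtain ⟨Q, hQ, hQ_density, hQ_mix⟩ := h B C hB_meas hC
    exact tendsto_measureReal_densityOneFilter_of_mixesAlong hb hQ hQ_density hQ_mix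
  tfae_finish

theorem mainTheorem9 {X : Type*} [MetricSpace X] [CompactSpace X]
    [MeasurableSpace X] [BorelSpace X]
    [AddAction (ℤ × ℤ) X] [ContinuousConstVAdd (ℤ × ℤ) X]
    (μ : Measure X) [IsProbabilityMeasure μ] [VAddInvariantMeasure (ℤ × ℤ) X μ]
    (β : ℝ) (a b : ℝ) (ha : 0 < a) (hb : 0 < b) :
    List.TFAE [
      IsDirectionalWeakMixing μ β a,
      ∀ B C : Set X, MeasurableSet B → MeasurableSet C →
        ∃ Q ⊆ directionStrip β b, HasStripDensityOne β b Q ∧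
          ∀ s : ℕ → ℤ × ℤ, (∀ i, s i ∈ Q) → StrictMono (fun i => (s i).1) →
            MixesAlong μ B C s,
      ∀ B C : Set X, MeasurableSet B → MeasurableSet C →
        ∃ Q ⊆ directionStrip β b, HasStripDensityOne β b Q ∧
          ∀ s : ℕ → ℤ × ℤ, (∀ i, s i ∈ Q) → Function.Injective s →
            MixesAlong μ B C s] :=
  mainTheorem9_general μ β a b ha hb
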